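/- **Setting.** For a $C^*$-algebra $\mathcal{C}$ let $M(\mathcal{C})\supseteq\mathcal{C}$ be its multiplier algebra. A representation $\pi$ of a $C^*$-algebra $\mathcal{S}$ on a Hilbert space $\mathcal{H}$ (resp. a morphism $\phi:\mathcal{S}\to M(\mathcal{T})$) is *non-degenerate* if $\pi(\mathcal{S})\mathcal{H}$ spans a dense subspace of $\mathcal{H}$ (resp. $\phi(\mathcal{S})\mathcal{T}$ spans a dense subspace of $\mathcal{T}$); it then has a unique extension $\tilde\pi$ (resp. $\tilde\phi$) to a unital $*$-homomorphism on $M(\mathcal{S})$. Let $G$ be a topological group, $\mathcal{A}$ a $C^*$-algebra and $\alpha:G\to\mathrm{Aut}(\mathcal{A})$ a group homomorphism (no continuity is assumed). Let $(\mathcal{L},\eta)$ be a host algebra for $G$: $\mathcal{L}$ is a $C^*$-algebra and $\eta:G\to U(M(\mathcal{L}))$ a homomorphism such that for every non-degenerate representation $\pi$ of $\mathcal{L}$ on a Hilbert space the unitary representation $\tilde\pi\circ\eta$ of $G$ is strongly continuous, and $\pi\mapsto\tilde\pi\circ\eta$ is injective on the non-degenerate representations on each Hilbert space. For a $C^*$-algebra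 $\mathcal{C}$ and maps $\eta_{\mathcal{A}}:\mathcal{A}\to M(\mathcal{C})$, $\eta_{\mathcal{L}}:\mathcal{L}\to M(\mathcal{C})$ consider the conditions - (CP1) $\eta_{\mathcal{A}}$ and $\eta_{\mathcal{L}}$ are morphisms of $C^*$-algebras. - (CP2) $\eta_{\mathcal{L}}$ is non-degenerate. - (CP3) $\tilde\eta_{\mathcal{L}}(\eta(g))\,\eta_{\mathcal{A}}(A)\,\tilde\eta_{\mathcal{L}}(\eta(g))^*=\eta_{\mathcal{A}}(\alpha_g(A))$ in $M(\mathcal{C})$ for all $g\in G$, $A\in\mathcal{A}$. - (CP4) $\eta_{\mathcal{A}}(\mathcal{A})\eta_{\mathcal{L}}(\mathcal{L})\subseteq\mathcal{C}$, and $\mathcal{C}$ is generated by this set as a $C^*$-algebra. A triple $(\mathcal{C},\eta_{\mathcal{A}},\eta_{\mathcal{L}})$ with (CP1)–(CP4) is a *crossed product host* for $(\alpha,\mathcal{L})$. If only (CP1) and (CP4) are given, a non-degenerate representation $\rho$ of $\mathcal{C}$ is an *$\mathcal{L}$-representation* if $\tilde\rho\circ\eta_{\mathcal{L}}$ is non-degenerate;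 then $U^\rho$ denotes the unitary representation $\widetilde{(\tilde\rho\circ\eta_{\mathcal{L}})}\circ\eta$ of $G$. Let $\rho_u$ be the universal $\mathcal{L}$-representation, i.e. the direct sum of the GNS representations of all states of $\mathcal{C}$ whose GNS representation is an $\mathcal{L}$-representation. Consider - (CP3') $\rho_u$ is faithful, and $U^{\rho_u}(g)\,\tilde\rho_u(\eta_{\mathcal{A}}(A))\,U^{\rho_u}(g)^*=\tilde\rho_u(\eta_{\mathcal{A}}(\alpha_g(A)))$ for all $g\in G$, $A\in\mathcal{A}$. Let $\mathcal{C}_{\mathcal{L}}:=\eta_{\mathcal{L}}(\mathcal{L})\,\mathcal{C}\,\eta_{\mathcal{L}}(\mathcal{L})$ (this set of products equals its closed linear span and is a hereditary subalgebra of $\mathcal{C}$), $$\mathcal{A}_{\mathcal{L}}:=\{A\in\mathcal{A}\mid \eta_{\mathcal{A}}(A)\mathcal{C}_{\mathcal{L}}\subseteq\mathcal{C}_{\mathcal{L}}\ \text{and}\ \eta_{\mathcal{A}}(A^*)\mathcal{C}_{\mathcal{L}}\subseteq\mathcal{C}_{\mathcal{L}}\},$$ which is a $C^*$-subalgebra of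 $\mathcal{A}$, and let $\mathcal{C}_{\mathcal{L}}^\vee:=C^*\big(\eta_{\mathcal{L}}(\mathcal{L})\eta_{\mathcal{A}}(\mathcal{A}_{\mathcal{L}})\big)\subseteq\mathcal{C}$. **Proposition.** Suppose that $(\mathcal{C},\eta_{\mathcal{A}},\eta_{\mathcal{L}})$ satisfies (CP1), (CP3') and (CP4). Then each $\alpha_g$ restricts to an automorphism of $\mathcal{A}_{\mathcal{L}}$, giving an action $\alpha\!\restriction\!\mathcal{A}_{\mathcal{L}}:G\to\mathrm{Aut}(\mathcal{A}_{\mathcal{L}})$; the formulas $$\eta_{\mathcal{A}}^\vee(A)C:=\eta_{\mathcal{A}}(A)C,\qquad \eta_{\mathcal{L}}^\vee(L)C:=\eta_{\mathcal{L}}(L)C\qquad (A\in\mathcal{A}_{\mathcal{L}},\ L\in\mathcal{L},\ C\in\mathcal{C}_{\mathcal{L}}^\vee)$$ define morphisms $\eta_{\mathcal{A}}^\vee:\mathcal{A}_{\mathcal{L}}\to M(\mathcal{C}_{\mathcal{L}}^\vee)$ and $\eta_{\mathcal{L}}^\vee:\mathcal{L}\to M(\mathcal{C}_{\mathcal{L}}^\vee)$;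 and the triple $(\mathcal{C}_{\mathcal{L}}^\vee,\eta_{\mathcal{A}}^\vee,\eta_{\mathcal{L}}^\vee)$ satisfies (CP1)–(CP4) for $\alpha\!\restriction\!\mathcal{A}_{\mathcal{L}}$. Hence it is a (not necessarily full) crossed product host for $(\alpha\!\restriction\!\mathcal{A}_{\mathcal{L}},\mathcal{L})$. -/

import Mathlib

open scoped MultiplierAlgebra ComplexOrder InnerProductSpace

noncomputable section

namespace CrossedProductHost

/-! ### Multiplier extensions -/

section Extension

variable {S T : Type*} [NonUnitalCStarAlgebra S] [NonUnitalCStarAlgebra T]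

lemma fst_mul (m : 𝓜(ℂ, S)) (a b : S) : m.fst (a * b) = m.fst a * b := by
  have key : ∀ x : S, x * (m.fst (a * b) - m.fst a * b) = 0 := fun x => by
    rw [mul_sub, ← m.central, ← mul_assoc, ← mul_assoc, ← m.central, sub_self]
  have h := key (star (m.fst (a * b) - m.fst a * b))
  exact sub_eq_zero.1 (CStarRing.star_mul_self_eq_zero_iff _ |>.1 h)

section Operator

variable {E : Type*} [NormedAddCommGroup E] [NormedSpace ℂ E]

lemma eq_of_dense_act {S : Type*} {π : S → E → E}
    (hd : Dense (Submodule.span ℂ {x : E | ∃ s v, π s v = x} : Set E))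
    {f g : E →L[ℂ] E} (h : ∀ s v, f (π s v) = g (π s v)) : f = g := by
  refine ContinuousLinearMap.ext_on hd ?_
  rintro _ ⟨s, v, rfl⟩
  exact h s v

lemma exists_extension_operator [CompleteSpace E] (π : S →ₗ[ℂ] (E →L[ℂ] E))
    (hmul : ∀ s t v, π (s * t) v = π s (π t v)) (hnorm : ∀ s, ‖π s‖ ≤ ‖s‖)
    (hd : Dense (Submodule.span ℂ {x : E | ∃ s v, π s v = x} : Set E)) (m : 𝓜(ℂ, S)) :
    ∃ f : E →L[ℂ] E, ∀ s v, f (π s v) = π (m.fst s) v := by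
  let e : TensorProduct ℂ S E →ₗ[ℂ] E :=
    TensorProduct.lift (ContinuousLinearMap.coeLM ℂ ∘ₗ π)
  let f : TensorProduct ℂ S E →ₗ[ℂ] E :=
    TensorProduct.lift (ContinuousLinearMap.coeLM ℂ ∘ₗ π ∘ₗ (m.fst : S →ₗ[ℂ] S))
  have he : ∀ s v, e (s ⊗ₜ v) = π s v := fun s v => rfl
  have hf : ∀ s v, f (s ⊗ₜ v) = π (m.fst s) v := fun s v => rfl
  have hc : Continuous π := AddMonoidHomClass.continuous_of_bound π 1 (by simpa using hnorm)
  have hdense : DenseRange e := by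
    refine hd.mono ?_
    change ((Submodule.span ℂ {x : E | ∃ s v, π s v = x} : Submodule ℂ E) : Set E) ⊆
      (LinearMap.range e : Set E)
    refine SetLike.coe_subset_coe.2 (Submodule.span_le.2 ?_)
    rintro _ ⟨s, v, rfl⟩
    exact ⟨s ⊗ₜ v, he s v⟩
  let _ := CStarAlgebra.spectralOrder S
  have := CStarAlgebra.spectralOrderedRing S
  have hu := CStarAlgebra.increasingApproximateUnit S
  have hlim : ∀ x, Filter.Tendsto (fun u => π (m.fst u) (e x)) (CStarAlgebra.approximateUnit S)
      (nhds (f x)) := by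
    intro x
    induction x using TensorProduct.induction_on with
    | zero => simp
    | tmul s v =>
      rw [he, hf]
      have h1 := hu.tendsto_mul_right s
      have h2 : Continuous fun a : S => π (m.fst a) v :=
        ((ContinuousLinearMap.apply ℂ E v).continuous.comp hc).comp m.fst.continuous
      refine ((h2.tendsto s).comp h1).congr fun u => ?_
      simp [fst_mul, hmul]
    | add x y hx hy => simpa using hx.add hy
  have hb : ∀ x, ‖f x‖ ≤ ‖m‖ * ‖e x‖ := by
    intro x
    refine le_of_tendsto (hlim x).norm ?_
    filter_upwards [hu.eventually_norm] with u hu1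
    calc ‖π (m.fst u) (e x)‖ ≤ ‖π (m.fst u)‖ * ‖e x‖ := ContinuousLinearMap.le_opNorm _ _
      _ ≤ ‖m‖ * ‖e x‖ := by
        gcongr
        calc ‖π (m.fst u)‖ ≤ ‖m.fst u‖ := hnorm _
          _ ≤ ‖m.fst‖ * ‖u‖ := m.fst.le_opNorm u
          _ ≤ ‖m.fst‖ * 1 := by gcongr
          _ = ‖m‖ := by simp
  refine ⟨f.extendOfNorm e, fun s v => ?_⟩
  rw [← he, LinearMap.extendOfNorm_eq hdense ⟨‖m‖, hb⟩, hf]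

end Operator

section Rep

variable {H : Type*} [NormedAddCommGroup H] [InnerProductSpace ℂ H] [CompleteSpace H]

/-- A representation `π` of a C⋆-algebra on a Hilbert space `H` is non-degenerate if the
vectors `π(s) v` span a dense subspace. -/
def IsNondegenerateRep (π : S →⋆ₙₐ[ℂ] (H →L[ℂ] H)) : Prop :=
  Dense (Submodule.span ℂ {x : H | ∃ s v, π s v = x} : Set H)

theorem repExt_unique {π : S →⋆ₙₐ[ℂ] (H →L[ℂ] H)} (hπ : IsNondegenerateRep π)
    {ψ₁ ψ₂ : 𝓜(ℂ, S) →⋆ₙₐ[ℂ] (H →L[ℂ] H)} (h₁ : ∀ s : S, ψ₁ (s : 𝓜(ℂ, S)) = π s)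
    (h₂ : ∀ s : S, ψ₂ (s : 𝓜(ℂ, S)) = π s) : ψ₁ = ψ₂ := by
  ext1 m
  refine eq_of_dense_act hπ fun s v => ?_
  have hm : m * (s : 𝓜(ℂ, S)) = ((m.fst s : S) : 𝓜(ℂ, S)) := by
    ext x
    · simp [fst_mul]
    · simp [m.central]
  have k : ∀ ψ : 𝓜(ℂ, S) →⋆ₙₐ[ℂ] (H →L[ℂ] H), (∀ s : S, ψ (s : 𝓜(ℂ, S)) = π s) →
      ψ m (π s v) = π (m.fst s) v := fun ψ h => by
    rw [← h, ← h, ← hm, map_mul]; rfl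
  rw [k ψ₁ h₁, k ψ₂ h₂]

theorem exists_repExt (π : S →⋆ₙₐ[ℂ] (H →L[ℂ] H)) (hπ : IsNondegenerateRep π) :
    ∃ ψ : 𝓜(ℂ, S) →⋆ₐ[ℂ] (H →L[ℂ] H), ∀ s : S, ψ (s : 𝓜(ℂ, S)) = π s := by
  let π' : S →ₗ[ℂ] (H →L[ℂ] H) := (π : S →ₗ[ℂ] (H →L[ℂ] H))
  have hex := exists_extension_operator π' (fun s t v => by simp [π'])
    (NonUnitalStarAlgHom.norm_apply_le π) hπ
  choose F hF using hex
  replace hF : ∀ m s v, F m (π s v) = π (m.fst s) v := hF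
  have hext : ∀ {f g : H →L[ℂ] H}, (∀ s v, f (π s v) = g (π s v)) → f = g :=
    fun h => eq_of_dense_act hπ h
  refine ⟨{ toFun := F, map_one' := ?_, map_mul' := ?_, map_zero' := ?_, map_add' := ?_,
            commutes' := ?_, map_star' := ?_ }, ?_⟩
  · exact hext fun s v => by simp [hF]
  · exact fun m n => hext fun s v => by simp [hF]
  · exact hext fun s v => by simp [hF]
  · exact fun m n => hext fun s v => by simp [hF]
  · exact fun z => hext fun s v => by simp [hF, Algebra.algebraMap_eq_smul_one]
  · intro m
    refine hext fun s v => ?_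
    refine (Dense.eq_of_inner_left (𝕜 := ℂ) hπ ?_)
    intro y hy
    induction hy using Submodule.span_induction with
    | mem y hy =>
      obtain ⟨t, w, rfl⟩ := hy
      change ⟪F (star m) (π s v), π t w⟫_ℂ = ⟪(F m).adjoint (π s v), π t w⟫_ℂ
      rw [ContinuousLinearMap.adjoint_inner_left, hF, hF]
      have adj : ∀ (a b : S) (v w : H), ⟪π a v, π b w⟫_ℂ = ⟪v, π (star a * b) w⟫_ℂ := by
        intro a b v w
        rw [map_mul, map_star, ContinuousLinearMap.star_eq_adjoint,
          mul_apply_eq_comp, ContinuousLinearMap.adjoint_inner_right]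
      rw [adj, adj]
      simp [m.central]
    | zero => simp
    | add x y _ _ hx hy => rw [inner_add_right, inner_add_right, hx, hy]
    | smul a x _ hx => rw [inner_smul_right, inner_smul_right, hx]
  · intro s
    exact hext fun t v => by
      change F s (π t v) = _
      simp [hF]

/-- The multiplier extension `π̃ : M(S) → B(H)` of a non-degenerate representation `π` of `S`:
the unique representation of `M(S)` that agrees with `π` on `S`. -/
def repExt (π : S →⋆ₙₐ[ℂ] (H →L[ℂ] H)) (hπ : IsNondegenerateRep π) :
    𝓜(ℂ, S) →⋆ₐ[ℂ] (H →L[ℂ] H) :=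
  (exists_repExt π hπ).choose

@[simp] theorem repExt_coe (π : S →⋆ₙₐ[ℂ] (H →L[ℂ] H)) (hπ : IsNondegenerateRep π) (s : S) :
    repExt π hπ (s : 𝓜(ℂ, S)) = π s :=
  (exists_repExt π hπ).choose_spec s

end Rep

/-- A morphism `φ : S → M(T)` is non-degenerate if `φ(S) T` spans a dense subspace of `T`. -/
def IsNondegenerateHom (φ : S →⋆ₙₐ[ℂ] 𝓜(ℂ, T)) : Prop :=
  Dense (Submodule.span ℂ {x : T | ∃ s t, (φ s).fst t = x} : Set T)

theorem homExt_unique {φ : S →⋆ₙₐ[ℂ] 𝓜(ℂ, T)} (hφ : IsNondegenerateHom φ)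
    {ψ₁ ψ₂ : 𝓜(ℂ, S) →⋆ₙₐ[ℂ] 𝓜(ℂ, T)} (h₁ : ∀ s : S, ψ₁ (s : 𝓜(ℂ, S)) = φ s)
    (h₂ : ∀ s : S, ψ₂ (s : 𝓜(ℂ, S)) = φ s) : ψ₁ = ψ₂ := by
  have hfst : ∀ m, (ψ₁ m).fst = (ψ₂ m).fst := by
    intro m
    refine eq_of_dense_act hφ fun s t => ?_
    have hm : m * (s : 𝓜(ℂ, S)) = ((m.fst s : S) : 𝓜(ℂ, S)) := by
      ext x
      · simp [fst_mul]
      · simp [m.central]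
    have k : ∀ ψ : 𝓜(ℂ, S) →⋆ₙₐ[ℂ] 𝓜(ℂ, T), (∀ s : S, ψ (s : 𝓜(ℂ, S)) = φ s) →
        (ψ m).fst ((φ s).fst t) = (φ (m.fst s)).fst t := fun ψ h => by
      rw [← h, ← h, ← hm, map_mul]; rfl
    rw [k ψ₁ h₁, k ψ₂ h₂]
  ext1 m
  refine DoubleCentralizer.ext _ _ _ _ (Prod.ext (hfst m) ?_)
  ext x
  have h := congrArg (fun f => star (f (star x))) (hfst (star m))
  rw [map_star ψ₁, map_star ψ₂] at h
  simpa only [DoubleCentralizer.star_fst, star_star] using h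

theorem exists_homExt (φ : S →⋆ₙₐ[ℂ] 𝓜(ℂ, T)) (hφ : IsNondegenerateHom φ) :
    ∃ ψ : 𝓜(ℂ, S) →⋆ₐ[ℂ] 𝓜(ℂ, T), ∀ s : S, ψ (s : 𝓜(ℂ, S)) = φ s := by
  let π' : S →ₗ[ℂ] (T →L[ℂ] T) :=
    { toFun := fun s => (φ s).fst
      map_add' := fun a b => by simp
      map_smul' := fun a b => by simp }
  have hex := exists_extension_operator π' (fun s t v => by simp [π'])
    (fun s => by simpa [π'] using NonUnitalStarAlgHom.norm_apply_le φ s) hφ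
  choose F hF using hex
  replace hF : ∀ m s v, F m ((φ s).fst v) = (φ (m.fst s)).fst v := hF
  have hext : ∀ {f g : T →L[ℂ] T}, (∀ s v, f ((φ s).fst v) = g ((φ s).fst v)) → f = g :=
    fun h => eq_of_dense_act hφ h
  let st : T →L⋆[ℂ] T := ((starₗᵢ ℂ : T ≃ₗᵢ⋆[ℂ] T) : T →L⋆[ℂ] T)
  have adj : ∀ m x y, star (F (star m) x) * y = star x * F m y := by
    intro m x y
    have cl : ∀ y, IsClosed {x | star (F (star m) x) * y = star x * F m y} := fun y =>
      isClosed_eq (by fun_prop) (by fun_prop)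
    have cl' : ∀ x, IsClosed {y | star (F (star m) x) * y = star x * F m y} := fun x =>
      isClosed_eq (by fun_prop) (by fun_prop)
    have adj' : ∀ (a b : S) (v w : T),
        star ((φ a).fst v) * (φ b).fst w = star v * (φ (star a * b)).fst w := by
      intro a b v w
      have := (φ (star a)).central (star v) ((φ b).fst w)
      rw [map_star φ, DoubleCentralizer.star_snd, star_star] at this
      rw [this, map_mul φ, map_star φ]
      rfl
    refine hφ.induction (P := fun x => star (F (star m) x) * y = star x * F m y) ?_ (cl y) x
    intro x hx
    refine hφ.induction (P := fun y => star (F (star m) x) * y = star x * F m y) ?_ (cl' x) y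
    intro y hy
    induction hx using Submodule.span_induction with
    | mem x hx =>
      obtain ⟨s, v, rfl⟩ := hx
      induction hy using Submodule.span_induction with
      | mem y hy =>
        obtain ⟨t, w, rfl⟩ := hy
        rw [hF, hF, adj', adj']
        simp [m.central]
      | zero => simp
      | add x y _ _ hx hy => rw [map_add, mul_add, mul_add, hx, hy]
      | smul a x _ hx => rw [map_smul, mul_smul_comm, mul_smul_comm, hx]
    | zero => simp
    | add x y _ _ hx hy => rw [map_add, star_add, star_add, add_mul, add_mul, hx, hy]
    | smul a x _ hx => rw [map_smul, star_smul, star_smul, smul_mul_assoc, smul_mul_assoc, hx]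
  let Ψ : 𝓜(ℂ, S) → 𝓜(ℂ, T) := fun m =>
    { fst := F m
      snd := (st.comp (F (star m))).comp st
      central := fun x y => by
        have := adj m (star x) y
        rw [star_star] at this
        exact this }
  have hΨ : ∀ {m : 𝓜(ℂ, S)} {n : 𝓜(ℂ, T)}, F m = n.fst → F (star m) = (star n).fst → Ψ m = n := by
    intro m n h1 h2
    refine DoubleCentralizer.ext _ _ _ _ (Prod.ext h1 ?_)
    ext x
    change star (F (star m) (star x)) = n.snd x
    rw [h2]; simp
  have hone : F 1 = 1 := hext fun s v => by simp [hF]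
  have hmul : ∀ m n, F (m * n) = F m * F n := fun m n => hext fun s v => by simp [hF]
  have hzero : F 0 = 0 := hext fun s v => by simp [hF]
  have hadd : ∀ m n, F (m + n) = F m + F n := fun m n => hext fun s v => by simp [hF]
  have halg : ∀ z : ℂ, F (algebraMap ℂ _ z) = algebraMap ℂ _ z :=
    fun z => hext fun s v => by simp [hF, Algebra.algebraMap_eq_smul_one]
  have hstar : ∀ m, Ψ (star m) = star (Ψ m) := fun m => by
    refine DoubleCentralizer.ext _ _ _ _ (Prod.ext ?_ ?_)
    · ext x
      change F (star m) x = star (star (F (star m) (star (star x))))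
      simp
    · ext x
      change star (F (star (star m)) (star x)) = star (F m (star x))
      simp
  have hfs : ∀ m, (star (Ψ m)).fst = F (star m) := fun m => by rw [← hstar]
  refine ⟨{ toFun := Ψ, map_one' := ?_, map_mul' := ?_, map_zero' := ?_, map_add' := ?_,
            commutes' := ?_, map_star' := hstar }, ?_⟩
  · exact hΨ hone (by simpa using hone)
  · intro m n
    refine hΨ (hmul m n) ?_
    rw [star_mul, star_mul, hmul, DoubleCentralizer.mul_fst, hfs, hfs]
  · exact hΨ hzero (by simpa using hzero)
  · intro m n
    refine hΨ (hadd m n) ?_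
    rw [star_add, star_add, hadd, DoubleCentralizer.add_fst, hfs, hfs]
  · intro z
    refine hΨ (halg z) ?_
    rw [← algebraMap_star_comm, ← algebraMap_star_comm, halg]
    simp
  · intro s
    have hs : ∀ s : S, F (s : 𝓜(ℂ, S)) = (φ s).fst := fun s => hext fun t v => by simp [hF]
    refine hΨ (hs s) ?_
    have : star (s : 𝓜(ℂ, S)) = ((star s : S) : 𝓜(ℂ, S)) :=
      (map_star (DoubleCentralizer.coeHom (𝕜 := ℂ) (A := S)) s).symm
    rw [this, hs, map_star φ]

/-- The multiplier extension `φ̃ : M(S) → M(T)` of a non-degenerate morphism `φ : S → M(T)`: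
the unique morphism on `M(S)` that agrees with `φ` on `S`. -/
def homExt (φ : S →⋆ₙₐ[ℂ] 𝓜(ℂ, T)) (hφ : IsNondegenerateHom φ) : 𝓜(ℂ, S) →⋆ₐ[ℂ] 𝓜(ℂ, T) :=
  (exists_homExt φ hφ).choose

@[simp] theorem homExt_coe (φ : S →⋆ₙₐ[ℂ] 𝓜(ℂ, T)) (hφ : IsNondegenerateHom φ) (s : S) :
    homExt φ hφ (s : 𝓜(ℂ, S)) = φ s :=
  (exists_homExt φ hφ).choose_spec s

end Extension

/-! ### Orthogonal direct sums of representations -/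

section DirectSum

variable {S : Type*} [NonUnitalCStarAlgebra S] {ι : Type*} {H : ι → Type*}
  [∀ i, NormedAddCommGroup (H i)] [∀ i, InnerProductSpace ℂ (H i)] [∀ i, CompleteSpace (H i)]

lemma norm_rep_apply_le {K : Type*} [NormedAddCommGroup K] [InnerProductSpace ℂ K]
    [CompleteSpace K] (π : S →⋆ₙₐ[ℂ] (K →L[ℂ] K)) (s : S) (v : K) : ‖π s v‖ ≤ ‖s‖ * ‖v‖ :=
  (ContinuousLinearMap.le_opNorm _ _).trans <| by
    gcongr; exact NonUnitalStarAlgHom.norm_apply_le π s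

lemma memℓp_rep (ρ : ∀ i, S →⋆ₙₐ[ℂ] (H i →L[ℂ] H i)) (s : S) (f : lp H 2) :
    Memℓp (fun i => ρ i s (f i)) 2 := by
  refine ((lp.memℓp ((‖s‖ : ℂ) • f)).mono' fun i => ?_)
  rw [lp.coeFn_smul, Pi.smul_apply, norm_smul]
  simpa using norm_rep_apply_le (ρ i) s (f i)

/-- The operator `(v_i) ↦ (ρ_i(s) v_i)` on the Hilbert space direct sum. -/
def sumOperator (ρ : ∀ i, S →⋆ₙₐ[ℂ] (H i →L[ℂ] H i)) (s : S) : lp H 2 →L[ℂ] lp H 2 :=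
  LinearMap.mkContinuous
    { toFun := fun f => (⟨fun i => ρ i s (f i), memℓp_rep ρ s f⟩ : lp H 2)
      map_add' := fun f g => by ext i; exact map_add (ρ i s) (f i) (g i)
      map_smul' := fun z f => by ext i; exact map_smul (ρ i s) z (f i) }
    ‖s‖ (fun f => by
      have h : ‖(⟨fun i => ρ i s (f i), memℓp_rep ρ s f⟩ : lp H 2)‖ ≤ ‖(‖s‖ : ℂ) • f‖ :=
        lp.norm_mono (by simp) fun i => by
          rw [lp.coeFn_smul, Pi.smul_apply, norm_smul]
          simpa using norm_rep_apply_le (ρ i) s (f i)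
      rw [norm_smul] at h
      simpa using h)

@[simp] lemma sumOperator_apply (ρ : ∀ i, S →⋆ₙₐ[ℂ] (H i →L[ℂ] H i)) (s : S) (f : lp H 2) (i : ι) :
    sumOperator ρ s f i = ρ i s (f i) := rfl

/-- The orthogonal direct sum `⨁ ρ_i` of representations, acting on the Hilbert space direct sum
(the `ℓ²`-sum) of the representation spaces. -/
def sumRep (ρ : ∀ i, S →⋆ₙₐ[ℂ] (H i →L[ℂ] H i)) : S →⋆ₙₐ[ℂ] (lp H 2 →L[ℂ] lp H 2) where
  toFun := sumOperator ρ
  map_smul' z s := by ext f i; simp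
  map_zero' := by ext f i; simp
  map_add' s t := by ext f i; simp
  map_mul' s t := by ext f i; simp
  map_star' s := by
    rw [ContinuousLinearMap.star_eq_adjoint, ContinuousLinearMap.eq_adjoint_iff]
    intro f g
    rw [lp.inner_eq_tsum, lp.inner_eq_tsum]
    refine tsum_congr fun i => ?_
    rw [sumOperator_apply, sumOperator_apply, map_star, ContinuousLinearMap.star_eq_adjoint,
      ContinuousLinearMap.adjoint_inner_left]

@[simp] lemma sumRep_apply (ρ : ∀ i, S →⋆ₙₐ[ℂ] (H i →L[ℂ] H i)) (s : S) (f : lp H 2) (i : ι) :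
    sumRep ρ s f i = ρ i s (f i) := rfl

lemma sumRep_nondegenerate (ρ : ∀ i, S →⋆ₙₐ[ℂ] (H i →L[ℂ] H i))
    (hρ : ∀ i, IsNondegenerateRep (ρ i)) : IsNondegenerateRep (sumRep ρ) := by
  classical
  set V := (Submodule.span ℂ {x : lp H 2 | ∃ s v, sumRep ρ s v = x}).topologicalClosure with hV
  have hVc : IsClosed (V : Set (lp H 2)) := Submodule.isClosed_topologicalClosure _
  have h1 : ∀ i (x : H i), lp.single 2 i x ∈ V := by
    intro i x
    have hcont : Continuous (lp.singleContinuousLinearMap ℂ H 2 i) :=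
      (lp.singleContinuousLinearMap ℂ H 2 i).continuous
    refine (hρ i).induction (P := fun x => lp.single 2 i x ∈ V) ?_ (hVc.preimage hcont) x
    intro y hy
    have hle : Submodule.span ℂ {x : H i | ∃ s v, ρ i s v = x} ≤
        V.comap (lp.singleContinuousLinearMap ℂ H 2 i : H i →ₗ[ℂ] lp H 2) := by
      refine Submodule.span_le.2 ?_
      rintro _ ⟨s, v, rfl⟩
      refine Submodule.le_topologicalClosure _ (Submodule.subset_span ⟨s, lp.single 2 i v, ?_⟩)
      ext j
      by_cases h : j = i
      · subst h; simp
      · simp [h]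
    exact hle hy
  intro f
  change f ∈ (V : Set (lp H 2))
  refine hVc.mem_of_tendsto (lp.hasSum_single (by simp) f) (Filter.Eventually.of_forall fun t => ?_)
  exact V.sum_mem fun i _ => h1 i (f i)

end DirectSum

/-! ### Host algebras and actions -/

section Host

variable {G : Type*} [Group G] {L : Type*} [NonUnitalCStarAlgebra L]

/-- The unitary representation `π̃ ∘ η` of `G` obtained from a non-degenerate representation `π`
of `L` and a homomorphism `η : G → U(M(L))`. -/
def groupRep (η : G →* unitary 𝓜(ℂ, L)) {H : Type*} [NormedAddCommGroup H]
    [InnerProductSpace ℂ H] [CompleteSpace H] (π : L →⋆ₙₐ[ℂ] (H →L[ℂ] H))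
    (hπ : IsNondegenerateRep π) : G →* unitary (H →L[ℂ] H) where
  toFun g := ⟨repExt π hπ (η g), Unitary.map_mem (repExt π hπ) (η g).2⟩
  map_one' := by ext1; simp
  map_mul' g h := by ext1; simp

end Host

universe u

/-- `(L, η)` is a host algebra for the topological group `G`: for every non-degenerate
representation `π` of `L` on a Hilbert space, `π̃ ∘ η` is strongly continuous, and `π` is determined
by `π̃ ∘ η`. (Hilbert spaces in the universe of `L` suffice, since all cyclic representations of `L`
live there.) -/
structure IsHostAlgebra {G : Type*} [Group G] [TopologicalSpace G] {L : Type u}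
    [NonUnitalCStarAlgebra L] (η : G →* unitary 𝓜(ℂ, L)) : Prop where
  continuous_groupRep : ∀ (H : Type u) [NormedAddCommGroup H] [InnerProductSpace ℂ H]
    [CompleteSpace H] (π : L →⋆ₙₐ[ℂ] (H →L[ℂ] H)) (hπ : IsNondegenerateRep π) (v : H),
    Continuous fun g => (groupRep η π hπ g : H →L[ℂ] H) v
  groupRep_injective : ∀ (H : Type u) [NormedAddCommGroup H] [InnerProductSpace ℂ H]
    [CompleteSpace H] (π₁ π₂ : L →⋆ₙₐ[ℂ] (H →L[ℂ] H)) (h₁ : IsNondegenerateRep π₁)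
    (h₂ : IsNondegenerateRep π₂), groupRep η π₁ h₁ = groupRep η π₂ h₂ → π₁ = π₂

section Triples

variable {G : Type*} [Group G] {A L C : Type*} [NonUnitalCStarAlgebra A]
  [NonUnitalCStarAlgebra L] [NonUnitalCStarAlgebra C]

/-- `η_A(A) η_L(L) ⊆ C`, and `C` is generated by this set as a C⋆-algebra. -/
structure IsGenerating (ηA : A →⋆ₙₐ[ℂ] 𝓜(ℂ, C)) (ηL : L →⋆ₙₐ[ℂ] 𝓜(ℂ, C)) : Prop where
  mul_mem : ∀ (a : A) (l : L), ∃ c : C, (c : 𝓜(ℂ, C)) = ηA a * ηL l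
  generates : (NonUnitalStarAlgebra.adjoin ℂ
    {c : C | ∃ (a : A) (l : L), (c : 𝓜(ℂ, C)) = ηA a * ηL l}).topologicalClosure = ⊤

/-- The triple `(C, η_A, η_L)` is a crossed product host for the action `α` of `G` on `A` and
the host algebra `(L, η)`. -/
structure IsCrossedProductHost (α : G →* (A ≃⋆ₐ[ℂ] A)) (η : G →* unitary 𝓜(ℂ, L))
    (ηA : A →⋆ₙₐ[ℂ] 𝓜(ℂ, C)) (ηL : L →⋆ₙₐ[ℂ] 𝓜(ℂ, C)) : Prop where
  nondegenerate : IsNondegenerateHom ηL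
  covariant : ∀ (g : G) (a : A),
    homExt ηL nondegenerate (η g) * ηA a * star (homExt ηL nondegenerate (η g)) = ηA (α g a)
  generating : IsGenerating ηA ηL

/-! ### The universal `L`-representation -/

section LRep

variable {H : Type*} [NormedAddCommGroup H] [InnerProductSpace ℂ H] [CompleteSpace H]

/-- The representation `ρ̃ ∘ φ` of `B`, for a morphism `φ : B → M(C)` and a non-degenerate
representation `ρ` of `C`. -/
def pullRep {B : Type*} [NonUnitalCStarAlgebra B] (φ : B →⋆ₙₐ[ℂ] 𝓜(ℂ, C))
    (ρ : C →⋆ₙₐ[ℂ] (H →L[ℂ] H)) (hρ : IsNondegenerateRep ρ) : B →⋆ₙₐ[ℂ] (H →L[ℂ] H) :=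
  (repExt ρ hρ).toNonUnitalStarAlgHom.comp φ

/-- A non-degenerate representation `ρ` of `C` is an `L`-representation if `ρ̃ ∘ η_L` is a
non-degenerate representation of `L`. -/
structure IsLRep (ηL : L →⋆ₙₐ[ℂ] 𝓜(ℂ, C)) (ρ : C →⋆ₙₐ[ℂ] (H →L[ℂ] H)) : Prop where
  nondegenerate : IsNondegenerateRep ρ
  pull_nondegenerate : IsNondegenerateRep (pullRep ηL ρ nondegenerate)

lemma sumRep_isLRep (ηL : L →⋆ₙₐ[ℂ] 𝓜(ℂ, C)) {ι : Type*} {H : ι → Type*}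
    [∀ i, NormedAddCommGroup (H i)] [∀ i, InnerProductSpace ℂ (H i)] [∀ i, CompleteSpace (H i)]
    (ρ : ∀ i, C →⋆ₙₐ[ℂ] (H i →L[ℂ] H i)) (hρ : ∀ i, IsLRep ηL (ρ i)) :
    IsLRep ηL (sumRep ρ) := by
  have hn := sumRep_nondegenerate ρ fun i => (hρ i).nondegenerate
  refine ⟨hn, ?_⟩
  have h : (repExt (sumRep ρ) hn).toNonUnitalStarAlgHom =
      sumRep fun i => (repExt (ρ i) (hρ i).nondegenerate).toNonUnitalStarAlgHom :=
    repExt_unique hn (fun c => repExt_coe _ _ c) fun c => by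
      ext f i
      change repExt (ρ i) (hρ i).nondegenerate c (f i) = ρ i c (f i)
      rw [repExt_coe]
  have h' : pullRep ηL (sumRep ρ) hn =
      sumRep fun i => pullRep ηL (ρ i) (hρ i).nondegenerate := by
    rw [pullRep, h]; rfl
  rw [h']
  exact sumRep_nondegenerate _ fun i => (hρ i).pull_nondegenerate

variable [PartialOrder C] [StarOrderedRing C]

/-- The states `ω` of `C` (positive functionals of norm one) whose GNS representation is an
`L`-representation. -/
def LState (ηL : L →⋆ₙₐ[ℂ] 𝓜(ℂ, C)) : Type _ :=
  {ω : C →ₚ[ℂ] ℂ // ‖(⟨ω.toLinearMap, map_continuous ω⟩ : C →L[ℂ] ℂ)‖ = 1 ∧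
    IsLRep ηL ω.gnsNonUnitalStarAlgHom}

/-- The Hilbert space of the universal `L`-representation. -/
abbrev UniversalSpace (ηL : L →⋆ₙₐ[ℂ] 𝓜(ℂ, C)) : Type _ :=
  lp (fun ω : LState ηL => ω.1.GNS) 2

/-- The universal `L`-representation `ρ_u` of `C`: the direct sum of the GNS representations of
all states whose GNS representation is an `L`-representation. -/
def universalRep (ηL : L →⋆ₙₐ[ℂ] 𝓜(ℂ, C)) :
    C →⋆ₙₐ[ℂ] (UniversalSpace ηL →L[ℂ] UniversalSpace ηL) :=
  sumRep fun ω : LState ηL => ω.1.gnsNonUnitalStarAlgHom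

theorem universalRep_isLRep (ηL : L →⋆ₙₐ[ℂ] 𝓜(ℂ, C)) : IsLRep ηL (universalRep ηL) :=
  sumRep_isLRep ηL _ fun ω => ω.2.2

/-- The covariance condition for a triple `(C, η_A, η_L)` with `η_L` possibly degenerate: the
universal `L`-representation `ρ_u` is faithful and, with `U` the unitary representation of `G`
obtained from the representation `ρ̃_u ∘ η_L` of the host algebra `L`, one has
`U(g) ρ̃_u(η_A(a)) U(g)* = ρ̃_u(η_A(α_g(a)))`. -/
structure IsUniversallyCovariant (α : G →* (A ≃⋆ₐ[ℂ] A)) (η : G →* unitary 𝓜(ℂ, L))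
    (ηA : A →⋆ₙₐ[ℂ] 𝓜(ℂ, C)) (ηL : L →⋆ₙₐ[ℂ] 𝓜(ℂ, C)) : Prop where
  faithful : Function.Injective (universalRep ηL)
  covariant : ∀ (g : G) (a : A),
    (groupRep η (pullRep ηL (universalRep ηL) (universalRep_isLRep ηL).nondegenerate)
        (universalRep_isLRep ηL).pull_nondegenerate g :
          UniversalSpace ηL →L[ℂ] UniversalSpace ηL) *
      pullRep ηA (universalRep ηL) (universalRep_isLRep ηL).nondegenerate a *
      star (groupRep η (pullRep ηL (universalRep ηL) (universalRep_isLRep ηL).nondegenerate)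
        (universalRep_isLRep ηL).pull_nondegenerate g :
          UniversalSpace ηL →L[ℂ] UniversalSpace ηL) =
    pullRep ηA (universalRep ηL) (universalRep_isLRep ηL).nondegenerate (α g a)

end LRep

/-! ### The restricted triple -/

/-- The hereditary subalgebra `C_L = η_L(L) C η_L(L)` of `C`. The set of these products is equal
to its closed linear span, which is the form used here. -/
def hereditary (ηL : L →⋆ₙₐ[ℂ] 𝓜(ℂ, C)) : Submodule ℂ C :=
  (Submodule.span ℂ {x : C | ∃ (l : L) (c : C) (l' : L),
    (x : 𝓜(ℂ, C)) = ηL l * (c : 𝓜(ℂ, C)) * ηL l'}).topologicalClosure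

/-- `A_L`, the subalgebra of all `a ∈ A` such that `η_A(a)` and `η_A(a*)` map `C_L` to itself. -/
def carrierAlgebra (ηA : A →⋆ₙₐ[ℂ] 𝓜(ℂ, C)) (ηL : L →⋆ₙₐ[ℂ] 𝓜(ℂ, C)) :
    NonUnitalStarSubalgebra ℂ A where
  carrier := {a : A | (∀ c ∈ hereditary ηL, (ηA a).fst c ∈ hereditary ηL) ∧
    ∀ c ∈ hereditary ηL, (ηA (star a)).fst c ∈ hereditary ηL}
  add_mem' {a b} ha hb := ⟨fun c hc => by
      simpa using add_mem (ha.1 c hc) (hb.1 c hc), fun c hc => by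
      simpa [map_add ηA] using add_mem (ha.2 c hc) (hb.2 c hc)⟩
  zero_mem' := ⟨fun c _ => by simp, fun c _ => by simp⟩
  mul_mem' {a b} ha hb := ⟨fun c hc => by
      simpa using ha.1 _ (hb.1 c hc), fun c hc => by
      rw [star_mul, map_mul ηA]; exact hb.2 _ (ha.2 c hc)⟩
  smul_mem' z a ha := ⟨fun c hc => by
      simpa using Submodule.smul_mem _ z (ha.1 c hc), fun c hc => by
      rw [star_smul, map_smul ηA]; exact Submodule.smul_mem _ (star z) (ha.2 c hc)⟩
  star_mem' {a} ha := ⟨ha.2, by simpa only [star_star] using ha.1⟩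

instance carrierAlgebra_isClosed (ηA : A →⋆ₙₐ[ℂ] 𝓜(ℂ, C)) (ηL : L →⋆ₙₐ[ℂ] 𝓜(ℂ, C)) :
    IsClosed (carrierAlgebra ηA ηL : Set A) := by
  have hc : Continuous ηA :=
    AddMonoidHomClass.continuous_of_bound ηA 1 (by simpa using NonUnitalStarAlgHom.norm_apply_le ηA)
  have hfst : ∀ c : C, Continuous fun m : 𝓜(ℂ, C) => m.fst c := fun c => by
    let φ : 𝓜(ℂ, C) →ₗ[ℂ] C :=
      { toFun := fun m => m.fst c
        map_add' := fun m n => by simp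
        map_smul' := fun z m => by simp }
    exact AddMonoidHomClass.continuous_of_bound φ ‖c‖ fun m => by
      rw [mul_comm, ← DoubleCentralizer.norm_fst m]
      exact m.fst.le_opNorm c
  have hh : IsClosed (hereditary ηL : Set C) := Submodule.isClosed_topologicalClosure _
  have : (carrierAlgebra ηA ηL : Set A) =
      (⋂ c ∈ hereditary ηL, {a | (ηA a).fst c ∈ hereditary ηL}) ∩
      (⋂ c ∈ hereditary ηL, {a | (ηA (star a)).fst c ∈ hereditary ηL}) := by
    ext a
    simp only [Set.mem_inter_iff, Set.mem_iInter]
    rfl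
  rw [this]
  exact (isClosed_biInter fun c _ => hh.preimage ((hfst c).comp hc)).inter
    (isClosed_biInter fun c _ => hh.preimage ((hfst c).comp (hc.comp continuous_star)))

/-- `C_L^∨ = C*(η_L(L) η_A(A_L))`, the C⋆-subalgebra of `C` generated by the products
`η_L(l) η_A(a)` with `l ∈ L` and `a ∈ A_L`. -/
def restrictedAlgebra (ηA : A →⋆ₙₐ[ℂ] 𝓜(ℂ, C)) (ηL : L →⋆ₙₐ[ℂ] 𝓜(ℂ, C)) :
    NonUnitalStarSubalgebra ℂ C :=
  (NonUnitalStarAlgebra.adjoin ℂ {c : C | ∃ l : L, ∃ a ∈ carrierAlgebra ηA ηL,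
    (c : 𝓜(ℂ, C)) = ηL l * ηA a}).topologicalClosure

instance restrictedAlgebra_isClosed (ηA : A →⋆ₙₐ[ℂ] 𝓜(ℂ, C)) (ηL : L →⋆ₙₐ[ℂ] 𝓜(ℂ, C)) :
    IsClosed (restrictedAlgebra ηA ηL : Set C) :=
  NonUnitalStarSubalgebra.isClosed_topologicalClosure _

end Triples

end CrossedProductHost

end

noncomputable section

namespace CrossedProductHost

/-! ### Elements of a C⋆-algebra inside its multiplier algebra -/

section Multiplier

variable {S : Type*} [NonUnitalCStarAlgebra S]

/-! Everything is read off in a faithful covariant `L`-representation `ρ`; the universal one is such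
a representation, and these are its only properties that enter. Let `U g` be the image of `η g`
under the extension of `ρ̃ ∘ η_L` to `M(L)`. As `M(L)` multiplies `L` into itself, `U g · ρ(η_L(l) c
η_L(l')) = ρ(η_L(η(g) l) c η_L(l'))`, so left multiplication by `U g` preserves `ρ(C_L)`. By
covariance `η_A(α_g a)` acts as `U g`, `a`, `(U g)*` in succession; hence it preserves `C_L`
whenever `η_A(a)` does, and `A_L` is `α`-invariant (`IsCovariantRep.mem_carrierAlgebra`).

That `A_L` and `L` act on `C_L^∨` is a factorization argument: products are dense in a C⋆-algebra,
so a middle factor `l` or `b` may be split in two, and each half joins its neighbour to form an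
element of `C_L^∨` (`carrier_fst_mem`, `host_fst_mem`). Non-degeneracy rests on `η_A(A_L) η_L(L) ⊆
C_L` (`mul_mem_hereditary`), because an approximate unit of `L` converges strongly to the identity
on `C_L`. Covariance then holds in `M(C_L^∨)`, since `ρ` intertwines the multiplier extension of the
restricted `η_L` with `U` (`rep_homExt`) and `ρ` is injective. -/

theorem mul_coe (m : 𝓜(ℂ, S)) (s : S) : m * (s : 𝓜(ℂ, S)) = ((m.fst s : S) : 𝓜(ℂ, S)) := by
  ext x
  · simp [fst_mul]
  · simp [m.central]

theorem coe_mul_coe (s t : S) : ((s * t : S) : 𝓜(ℂ, S)) = s * t :=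
  map_mul (DoubleCentralizer.coeHom (𝕜 := ℂ) (A := S)) s t

theorem star_coe (s : S) : star (s : 𝓜(ℂ, S)) = ((star s : S) : 𝓜(ℂ, S)) :=
  (map_star (DoubleCentralizer.coeHom (𝕜 := ℂ) (A := S)) s).symm

/-- The centrality relation expresses `m.snd x * y` through `m.fst y`, and no nonzero element of a
C⋆-algebra annihilates the whole algebra. Identities between multipliers therefore need checking on
the left action only. -/
theorem multiplier_ext {m n : 𝓜(ℂ, S)} (h : ∀ s, m.fst s = n.fst s) : m = n := by
  refine DoubleCentralizer.ext _ _ _ _ (Prod.ext (ContinuousLinearMap.ext h) ?_)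
  ext x
  have key : ∀ y : S, (m.snd x - n.snd x) * y = 0 := fun y => by
    rw [sub_mul, m.central, n.central, h, sub_self]
  exact sub_eq_zero.1 (CStarRing.mul_star_self_eq_zero_iff _ |>.1 (key _))

theorem coe_injective : Function.Injective fun s : S => (s : 𝓜(ℂ, S)) := fun s t h => by
  have key : ∀ y : S, (s - t) * y = 0 := fun y => by
    have := congrArg (fun m : 𝓜(ℂ, S) => m.fst y) h
    simpa [sub_mul, sub_eq_zero] using this
  exact sub_eq_zero.1 (CStarRing.mul_star_self_eq_zero_iff _ |>.1 (key _))

theorem isometry_coe : Isometry fun s : S => (s : 𝓜(ℂ, S)) :=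
  NonUnitalStarAlgHom.isometry (DoubleCentralizer.coeHom (𝕜 := ℂ) (A := S)) coe_injective

/-- The image in the multiplier algebra of a closed subset of the algebra is closed. -/
theorem isClosed_coe_image {P : Set S} (hP : IsClosed P) :
    IsClosed ((fun s : S => (s : 𝓜(ℂ, S))) '' P) :=
  isometry_coe.isClosedEmbedding.isClosedMap P hP

theorem coe_mem_image {P : Set S} {s : S} :
    (s : 𝓜(ℂ, S)) ∈ (fun s : S => (s : 𝓜(ℂ, S))) '' P ↔ s ∈ P :=
  coe_injective.mem_set_image

theorem continuous_starHom {T : Type*} [NonUnitalCStarAlgebra T] (φ : S →⋆ₙₐ[ℂ] T) :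
    Continuous φ :=
  AddMonoidHomClass.continuous_of_bound φ 1 (by simpa using NonUnitalStarAlgHom.norm_apply_le φ)

variable (S) in
theorem exists_isApproximateUnit : ∃ l : Filter S, l.IsApproximateUnit := by
  let _ := CStarAlgebra.spectralOrder S
  have := CStarAlgebra.spectralOrderedRing S
  exact ⟨_, (CStarAlgebra.increasingApproximateUnit S).toIsApproximateUnit⟩

/-- Products are dense: a continuous map that sends all products into a closed set sends
everything into it. -/
theorem mem_of_forall_mul_mem {X : Type*} [TopologicalSpace X] {f : S → X} (hf : Continuous f)
    {P : Set X} (hP : IsClosed P) (h : ∀ a b, f (a * b) ∈ P) (a : S) : f a ∈ P := by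
  obtain ⟨l, hl⟩ := exists_isApproximateUnit S
  have := hl.neBot
  exact hP.mem_of_tendsto ((hf.tendsto a).comp (hl.tendsto_mul_left a))
    (Filter.Eventually.of_forall fun u => h a u)

theorem homExt_apply {T : Type*} [NonUnitalCStarAlgebra T] {φ : S →⋆ₙₐ[ℂ] 𝓜(ℂ, T)}
    (hφ : IsNondegenerateHom φ) (m : 𝓜(ℂ, S)) (s : S) :
    homExt φ hφ m * φ s = φ (m.fst s) := by
  rw [← homExt_coe φ hφ, ← homExt_coe φ hφ, ← mul_coe, map_mul]

theorem repExt_apply {H : Type*} [NormedAddCommGroup H] [InnerProductSpace ℂ H] [CompleteSpace H]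
    {π : S →⋆ₙₐ[ℂ] (H →L[ℂ] H)} (hπ : IsNondegenerateRep π) (m : 𝓜(ℂ, S)) (s : S) :
    repExt π hπ m * π s = π (m.fst s) := by
  rw [← repExt_coe π hπ, ← repExt_coe π hπ, ← mul_coe, map_mul]

end Multiplier

/-! ### Restriction of multipliers to an invariant subalgebra -/

section Restrict

variable {B C : Type*} [NonUnitalCStarAlgebra B] [NonUnitalCStarAlgebra C]
  (D : NonUnitalStarSubalgebra ℂ C) [IsClosed (D : Set C)] (φ : B →⋆ₙₐ[ℂ] 𝓜(ℂ, C))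

/-- The restriction of an operator on `C` to an invariant closed subalgebra `D`. -/
def restrictOperator (f : C →L[ℂ] C) (h : ∀ d ∈ D, f d ∈ D) : D →L[ℂ] D where
  toFun d := ⟨f d, h d d.2⟩
  map_add' x y := by ext; simp
  map_smul' z x := by ext; simp
  cont := (f.continuous.comp continuous_subtype_val).subtype_mk _

/-- The right action of `φ b` is the left action of `φ (star b)` conjugated by the involution, and
`D` is closed under the involution. -/
theorem snd_mem {D : NonUnitalStarSubalgebra ℂ C} {φ : B →⋆ₙₐ[ℂ] 𝓜(ℂ, C)} (h : ∀ b, ∀ d ∈ D, (φ b).fst d ∈ D) (b : B) (d : C)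
    (hd : d ∈ D) : (φ b).snd d ∈ D := by
  have := star_mem (h (star b) (star d) (star_mem hd))
  rw [map_star φ] at this
  simpa using this

/-- If all `φ(b)` map `D` to itself, then `φ` restricts to a morphism `B → M(D)`. -/
def restrictHom (h : ∀ b, ∀ d ∈ D, (φ b).fst d ∈ D) : B →⋆ₙₐ[ℂ] 𝓜(ℂ, D) where
  toFun b :=
    { fst := restrictOperator D (φ b).fst (h b)
      snd := restrictOperator D (φ b).snd (snd_mem h b)
      central := fun x y => Subtype.ext ((φ b).central x y) }
  map_zero' := multiplier_ext fun d => Subtype.ext (by simp [restrictOperator])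
  map_add' a b := multiplier_ext fun d => Subtype.ext (by simp [restrictOperator])
  map_mul' a b := multiplier_ext fun d => Subtype.ext (by simp [restrictOperator])
  map_smul' z b := multiplier_ext fun d => Subtype.ext (by simp [restrictOperator])
  map_star' b := multiplier_ext fun d => Subtype.ext (by simp [restrictOperator, map_star φ])

@[simp] theorem restrictHom_fst (h : ∀ b, ∀ d ∈ D, (φ b).fst d ∈ D) (b : B) (d : D) :
    ((restrictHom D φ h b).fst d : C) = (φ b).fst d := rfl

end Restrict

/-! ### Invariance of the hereditary subalgebra and of the restricted algebra -/

section Triple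

variable {A L C : Type*} [NonUnitalCStarAlgebra A]
  [NonUnitalCStarAlgebra L] [NonUnitalCStarAlgebra C]
  {ηA : A →⋆ₙₐ[ℂ] 𝓜(ℂ, C)} {ηL : L →⋆ₙₐ[ℂ] 𝓜(ℂ, C)}

theorem isClosed_hereditary : IsClosed (hereditary ηL : Set C) :=
  Submodule.isClosed_topologicalClosure _

theorem mem_hereditary {x : C} (l : L) (c : C) (l' : L)
    (h : (x : 𝓜(ℂ, C)) = ηL l * (c : 𝓜(ℂ, C)) * ηL l') : x ∈ hereditary ηL :=
  Submodule.le_topologicalClosure _ (Submodule.subset_span ⟨l, c, l', h⟩)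

/-- A closed subspace containing all products `η_L(l) c η_L(l')` contains `C_L`. -/
theorem hereditary_le {P : Submodule ℂ C} (hP : IsClosed (P : Set C))
    (h : ∀ (x : C) (l : L) (c : C) (l' : L),
      (x : 𝓜(ℂ, C)) = ηL l * (c : 𝓜(ℂ, C)) * ηL l' → x ∈ P) : hereditary ηL ≤ P :=
  Submodule.topologicalClosure_minimal _
    (Submodule.span_le.2 fun x ⟨l, c, l', hx⟩ => h x l c l' hx) hP

/-- Split `l` as `l₁ l₂`. Then `c = η_A(a) η_L(l₁)` lies in `C` and is the limit of `c u` along an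
approximate unit of `C`, while `c u η_L(l₂) = η_A(a) (η_L(l₁) u η_L(l₂))` lies in `η_A(a) C_L ⊆
C_L`. -/
theorem mul_mem_hereditary (hgen : IsGenerating ηA ηL) {a : A} (ha : a ∈ carrierAlgebra ηA ηL)
    (l : L) {x : C} (hx : (x : 𝓜(ℂ, C)) = ηA a * ηL l) : x ∈ hereditary ηL := by
  rw [← SetLike.mem_coe, ← coe_mem_image, hx]
  have hcl := isClosed_coe_image (isClosed_hereditary (ηL := ηL))
  refine mem_of_forall_mul_mem (f := fun l => ηA a * ηL l)
    (continuous_const.mul (continuous_starHom ηL)) hcl (fun l₁ l₂ => ?_) l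
  obtain ⟨c, hc⟩ := hgen.mul_mem a l₁
  obtain ⟨F, hF⟩ := exists_isApproximateUnit C
  have := hF.neBot
  have hlim : Filter.Tendsto (fun u : C => ((c * u : C) : 𝓜(ℂ, C)) * ηL l₂) F
      (nhds ((c : 𝓜(ℂ, C)) * ηL l₂)) :=
    ((isometry_coe.continuous.tendsto c).comp (hF.tendsto_mul_left c)).mul_const _
  change ηA a * ηL (l₁ * l₂) ∈ _
  rw [map_mul ηL, ← mul_assoc, ← hc]
  refine hcl.mem_of_tendsto hlim (Filter.Eventually.of_forall fun u => ?_)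
  -- The element `u η_L(l₂)` of `C` is written as the adjoint of `η_L(l₂*) u*`, so that only left
  -- actions of multipliers occur.
  have hy : (ηL l₁ * ((star ((ηL (star l₂)).fst (star u)) : C) : 𝓜(ℂ, C))) =
      ηL l₁ * (u : 𝓜(ℂ, C)) * ηL l₂ := by
    rw [← star_coe, ← mul_coe, star_mul, ← map_star ηL, star_star, ← star_coe, star_star,
      mul_assoc]
  rw [mul_coe] at hy
  refine ⟨_, ha.1 _ (mem_hereditary l₁ u l₂ hy), ?_⟩
  change (((ηA a).fst _ : C) : 𝓜(ℂ, C)) = _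
  rw [← mul_coe, hy, coe_mul_coe, hc]
  simp only [mul_assoc]

theorem exists_coe_eq_mul (hgen : IsGenerating ηA ηL) (l : L) (a : A) :
    ∃ c : C, (c : 𝓜(ℂ, C)) = ηL l * ηA a := by
  obtain ⟨c, hc⟩ := hgen.mul_mem (star a) (star l)
  exact ⟨star c, by
    rw [← star_coe, hc, star_mul, ← map_star ηL, ← map_star ηA, star_star, star_star]⟩

theorem isClosed_restrictedAlgebra : IsClosed (restrictedAlgebra ηA ηL : Set C) :=
  NonUnitalStarSubalgebra.isClosed_topologicalClosure _

theorem left_mul_mem_restrictedAlgebra {a : A} (ha : a ∈ carrierAlgebra ηA ηL) (l : L) {x : C}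
    (hx : (x : 𝓜(ℂ, C)) = ηL l * ηA a) : x ∈ restrictedAlgebra ηA ηL :=
  NonUnitalStarSubalgebra.le_topologicalClosure _
    (NonUnitalStarAlgebra.subset_adjoin ℂ _ ⟨l, a, ha, hx⟩)

theorem right_mul_mem_restrictedAlgebra {a : A} (ha : a ∈ carrierAlgebra ηA ηL) (l : L) {x : C}
    (hx : (x : 𝓜(ℂ, C)) = ηA a * ηL l) : x ∈ restrictedAlgebra ηA ηL := by
  have := left_mul_mem_restrictedAlgebra (x := star x) (star_mem ha) (star l)
    (by rw [← star_coe, hx, star_mul, ← map_star ηL, ← map_star ηA])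
  simpa using star_mem this

/-- Induction principle: a closed subspace `P` with `P D ⊆ P` that contains the products
`η_L(l) η_A(a)` and `η_A(a) η_L(l)` contains `D = C_L^∨`. -/
theorem restrictedAlgebra_le {P : Submodule ℂ C} (hP : IsClosed (P : Set C))
    (hmul : ∀ x ∈ P, ∀ y ∈ restrictedAlgebra ηA ηL, x * y ∈ P)
    (hl : ∀ (x : C) (l : L), ∀ a ∈ carrierAlgebra ηA ηL, (x : 𝓜(ℂ, C)) = ηL l * ηA a → x ∈ P)
    (hr : ∀ (x : C) (l : L), ∀ a ∈ carrierAlgebra ηA ηL, (x : 𝓜(ℂ, C)) = ηA a * ηL l → x ∈ P)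
    {x : C} (hx : x ∈ restrictedAlgebra ηA ηL) : x ∈ P := by
  refine hP.closure_subset_iff.2 ?_ hx
  intro y hy
  -- The star subalgebra is the plain subalgebra generated by the set together with its adjoints,
  -- which gives the two families of generators. No closure of `P` under the involution is then
  -- needed.
  change y ∈ NonUnitalAlgebra.adjoin ℂ _ at hy
  induction hy using NonUnitalAlgebra.adjoin_induction with
  | mem y hy =>
    rcases hy with ⟨l, a, ha, h⟩ | ⟨l, a, ha, h⟩
    · exact hl y l a ha h
    · refine hr y (star l) (star a) (star_mem ha) ?_
      rw [map_star ηL, map_star ηA, ← star_mul, ← h, star_coe, star_star]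
  | add x y _ _ hx hy => exact add_mem hx hy
  | zero => exact zero_mem P
  | smul z x _ hx => exact P.smul_mem z hx
  | mul x y _ hy hx' _ =>
    exact hmul x hx' y (NonUnitalStarSubalgebra.le_topologicalClosure _ hy)

theorem isClosed_comap {m : 𝓜(ℂ, C)} {P : Submodule ℂ C} (hP : IsClosed (P : Set C)) :
    IsClosed (P.comap (m.fst : C →ₗ[ℂ] C) : Set C) :=
  hP.preimage m.fst.continuous

/-- `η_A(A_L) C_L^∨ ⊆ C_L^∨`. -/
theorem carrier_fst_mem (hgen : IsGenerating ηA ηL) {a : A} (ha : a ∈ carrierAlgebra ηA ηL)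
    {d : C} (hd : d ∈ restrictedAlgebra ηA ηL) : (ηA a).fst d ∈ restrictedAlgebra ηA ηL := by
  have hD := isClosed_restrictedAlgebra (ηA := ηA) (ηL := ηL)
  have hcl := isClosed_coe_image hD
  refine restrictedAlgebra_le (P := (restrictedAlgebra ηA ηL).toSubmodule.comap
    ((ηA a).fst : C →ₗ[ℂ] C)) (isClosed_comap hD) ?_ ?_ ?_ hd
  · intro x hx y hy
    change (ηA a).fst (x * y) ∈ restrictedAlgebra ηA ηL
    rw [fst_mul]
    exact mul_mem hx hy
  · intro x l b hb h
    change (ηA a).fst x ∈ (restrictedAlgebra ηA ηL : Set C)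
    rw [← coe_mem_image, ← mul_coe, h]
    -- For `l = l₁ l₂` the element is `(η_A(a) η_L(l₁)) (η_L(l₂) η_A(b))`, a product of two elements
    -- of `C_L^∨`.
    refine mem_of_forall_mul_mem (f := fun l => ηA a * (ηL l * ηA b)) (continuous_const.mul
      ((continuous_starHom ηL).mul continuous_const)) hcl (fun l₁ l₂ => ?_) l
    obtain ⟨x, hx⟩ := hgen.mul_mem a l₁
    obtain ⟨y, hy⟩ := exists_coe_eq_mul hgen l₂ b
    refine ⟨x * y, mul_mem (right_mul_mem_restrictedAlgebra ha l₁ hx)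
      (left_mul_mem_restrictedAlgebra hb l₂ hy), ?_⟩
    change ((x * y : C) : 𝓜(ℂ, C)) = _
    rw [coe_mul_coe, hx, hy, map_mul ηL]
    simp only [mul_assoc]
  · intro x l b hb h
    refine right_mul_mem_restrictedAlgebra (mul_mem ha hb) l ?_
    change (((ηA a).fst x : C) : 𝓜(ℂ, C)) = _
    rw [← mul_coe, h, map_mul ηA, mul_assoc]

/-- `η_L(L) C_L^∨ ⊆ C_L^∨`. -/
theorem host_fst_mem (hgen : IsGenerating ηA ηL) (l : L)
    {d : C} (hd : d ∈ restrictedAlgebra ηA ηL) : (ηL l).fst d ∈ restrictedAlgebra ηA ηL := by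
  have hD := isClosed_restrictedAlgebra (ηA := ηA) (ηL := ηL)
  have hcl := isClosed_coe_image hD
  refine restrictedAlgebra_le (P := (restrictedAlgebra ηA ηL).toSubmodule.comap
    ((ηL l).fst : C →ₗ[ℂ] C)) (isClosed_comap hD) ?_ ?_ ?_ hd
  · intro x hx y hy
    change (ηL l).fst (x * y) ∈ restrictedAlgebra ηA ηL
    rw [fst_mul]
    exact mul_mem hx hy
  · intro x l' b hb h
    refine left_mul_mem_restrictedAlgebra hb (l * l') ?_
    change (((ηL l).fst x : C) : 𝓜(ℂ, C)) = _
    rw [← mul_coe, h, map_mul ηL, mul_assoc]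
  · intro x l' b hb h
    change (ηL l).fst x ∈ (restrictedAlgebra ηA ηL : Set C)
    rw [← coe_mem_image, ← mul_coe, h]
    -- Here the middle factor is `b`. It is split inside `A_L`, a C⋆-algebra in its own right
    -- because it is closed in `A`, so that both halves stay in `A_L`.
    refine mem_of_forall_mul_mem (f := fun b : carrierAlgebra ηA ηL => ηL l * (ηA b * ηL l'))
      (continuous_const.mul (((continuous_starHom ηA).comp continuous_subtype_val).mul
        continuous_const)) hcl (fun b₁ b₂ => ?_) ⟨b, hb⟩
    obtain ⟨x, hx⟩ := exists_coe_eq_mul hgen l (b₁ : A)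
    obtain ⟨y, hy⟩ := hgen.mul_mem (b₂ : A) l'
    refine ⟨x * y, mul_mem (left_mul_mem_restrictedAlgebra b₁.2 l hx)
      (right_mul_mem_restrictedAlgebra b₂.2 l' hy), ?_⟩
    change ((x * y : C) : 𝓜(ℂ, C)) = _
    rw [coe_mul_coe, hx, hy, MulMemClass.coe_mul, map_mul ηA]
    simp only [mul_assoc]

end Triple

end CrossedProductHost

end

noncomputable section

namespace CrossedProductHost

/-! ### Nondegeneracy and generation for the restricted triple -/

section Restricted

variable {A L C : Type*} [NonUnitalCStarAlgebra A]
  [NonUnitalCStarAlgebra L] [NonUnitalCStarAlgebra C]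
  {ηA : A →⋆ₙₐ[ℂ] 𝓜(ℂ, C)} {ηL : L →⋆ₙₐ[ℂ] 𝓜(ℂ, C)}

/-- The restriction of `η_A` to `A_L`, acting on `C_L^∨`. -/
def restrictedA (hgen : IsGenerating ηA ηL) :
    carrierAlgebra ηA ηL →⋆ₙₐ[ℂ] 𝓜(ℂ, restrictedAlgebra ηA ηL) :=
  restrictHom (restrictedAlgebra ηA ηL)
    (ηA.comp (NonUnitalStarSubalgebraClass.subtype (carrierAlgebra ηA ηL)))
    fun a _ hd => carrier_fst_mem hgen a.2 hd

/-- The morphism `η_L`, acting on `C_L^∨`. -/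
def restrictedL (hgen : IsGenerating ηA ηL) : L →⋆ₙₐ[ℂ] 𝓜(ℂ, restrictedAlgebra ηA ηL) :=
  restrictHom (restrictedAlgebra ηA ηL) ηL fun l _ hd => host_fst_mem hgen l hd

@[simp] theorem restrictedA_fst (hgen : IsGenerating ηA ηL) (a : carrierAlgebra ηA ηL)
    (d : restrictedAlgebra ηA ηL) : ((restrictedA hgen a).fst d : C) = (ηA a).fst d := rfl

@[simp] theorem restrictedL_fst (hgen : IsGenerating ηA ηL) (l : L)
    (d : restrictedAlgebra ηA ηL) : ((restrictedL hgen l).fst d : C) = (ηL l).fst d := rfl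

/-- Along an approximate unit of `L`, `η_L(u) x → x` for `x ∈ C_L`. -/
theorem tendsto_of_mem_hereditary {F : Filter L} (hF : F.IsApproximateUnit)
    (hb : ∀ᶠ u in F, ‖u‖ ≤ 1) {x : C} (hx : x ∈ hereditary ηL) :
    Filter.Tendsto (fun u => (ηL u).fst x) F (nhds x) := by
  have hgenr : ∀ y ∈ Submodule.span ℂ {x : C | ∃ (l : L) (c : C) (l' : L),
      (x : 𝓜(ℂ, C)) = ηL l * (c : 𝓜(ℂ, C)) * ηL l'},
      Filter.Tendsto (fun u => (ηL u).fst y) F (nhds y) := by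
    intro y hy
    induction hy using Submodule.span_induction with
    | mem y hy =>
      obtain ⟨l, c, l', h⟩ := hy
      -- Convergence is tested in `M(C)`, where `y` factors as `η_L(l) c η_L(l')` and `u l → l`
      -- applies.
      refine (isometry_coe (S := C)).isUniformInducing.isInducing.tendsto_nhds_iff.2 ?_
      have hlim : Filter.Tendsto (fun u => ηL (u * l) * (c : 𝓜(ℂ, C)) * ηL l') F
          (nhds (ηL l * (c : 𝓜(ℂ, C)) * ηL l')) :=
        ((((continuous_starHom ηL).tendsto l).comp (hF.tendsto_mul_right l)).mul_const
          _).mul_const _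
      rw [← h] at hlim
      refine hlim.congr fun u => ?_
      change _ = (((ηL u).fst y : C) : 𝓜(ℂ, C))
      rw [← mul_coe, h, map_mul ηL]
      simp only [mul_assoc]
    | zero => simpa using tendsto_const_nhds
    | add x y _ _ hx hy => simpa using hx.add hy
    | smul z x _ hx => simpa using hx.const_smul z
  -- Passage from the span to its closure: since `η_L(u)` is a contraction, replacing `x` by a
  -- nearby `y` costs at most `ε / 3` twice, independently of `u`.
  rw [Metric.tendsto_nhds]
  intro ε hε
  obtain ⟨y, hy, hxy⟩ := Metric.mem_closure_iff.1 hx (ε / 3) (by positivity)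
  filter_upwards [Metric.tendsto_nhds.1 (hgenr y hy) (ε / 3) (by positivity), hb] with u hu hu1
  rw [dist_eq_norm] at *
  have h1 : ‖(ηL u).fst (x - y)‖ ≤ ‖x - y‖ := by
    refine ((ηL u).fst.le_opNorm _).trans (mul_le_of_le_one_left (norm_nonneg _) ?_)
    rw [DoubleCentralizer.norm_fst]
    exact (NonUnitalStarAlgHom.norm_apply_le ηL u).trans hu1
  have h2 : (ηL u).fst x - x = (ηL u).fst (x - y) + ((ηL u).fst y - y) - (x - y) := by
    rw [map_sub]; abel
  rw [h2]
  refine (norm_sub_le _ _).trans_lt ?_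
  have := norm_add_le ((ηL u).fst (x - y)) ((ηL u).fst y - y)
  linarith

/-- The closed span `V` of `η_L(L) C_L^∨` is a right ideal of `C_L^∨`, so it suffices to catch both
kinds of generators. Products `η_L(l₁ l₂) η_A(a)` have the required form visibly; `η_A(a) η_L(l)`
lies in `C_L`, hence is the limit of `η_L(u) η_A(a) η_L(l)` along an approximate unit. -/
theorem restrictedL_nondegenerate (hgen : IsGenerating ηA ηL) :
    IsNondegenerateHom (restrictedL hgen) := by
  let V : Submodule ℂ (restrictedAlgebra ηA ηL) := (Submodule.span ℂ
    {x | ∃ l d, ((restrictedL hgen) l).fst d = x}).topologicalClosure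
  let ι : restrictedAlgebra ηA ηL →ₗ[ℂ] C := (restrictedAlgebra ηA ηL).toSubmodule.subtype
  let P : Submodule ℂ C := V.map ι
  have hD := isClosed_restrictedAlgebra (ηA := ηA) (ηL := ηL)
  have hPc : IsClosed (P : Set C) :=
    hD.isClosedEmbedding_subtypeVal.isClosedMap _ (Submodule.isClosed_topologicalClosure _)
  have hbase : ∀ l, ∀ d ∈ restrictedAlgebra ηA ηL, (ηL l).fst d ∈ P := fun l d hd =>
    ⟨(restrictedL hgen l).fst ⟨d, hd⟩,
      Submodule.le_topologicalClosure _ (Submodule.subset_span ⟨l, ⟨d, hd⟩, rfl⟩), rfl⟩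
  have hVmul : ∀ x ∈ V, ∀ y, x * y ∈ V := by
    intro x hx y
    have hcl : IsClosed {x | x * y ∈ V} :=
      (Submodule.isClosed_topologicalClosure _).preimage (by fun_prop)
    refine hcl.closure_subset_iff.2 ?_ hx
    intro z hz
    induction hz using Submodule.span_induction with
    | mem z hz =>
      obtain ⟨l, d, rfl⟩ := hz
      refine Submodule.le_topologicalClosure _ (Submodule.subset_span ⟨l, d * y, ?_⟩)
      rw [fst_mul]
    | zero => simp
    | add a b _ _ ha hb => simpa [add_mul] using add_mem ha hb
    | smul z a _ ha => simpa [smul_mul_assoc] using V.smul_mem z ha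
  have hall : ∀ d ∈ restrictedAlgebra ηA ηL, d ∈ P := fun d hd => by
    refine restrictedAlgebra_le hPc ?_ ?_ ?_ hd
    · rintro _ ⟨x, hx, rfl⟩ y hy
      exact ⟨x * ⟨y, hy⟩, hVmul x hx _, rfl⟩
    · intro x l a ha h
      rw [← SetLike.mem_coe, ← coe_mem_image, h]
      refine mem_of_forall_mul_mem (f := fun l => ηL l * ηA a)
        ((continuous_starHom ηL).mul continuous_const) (isClosed_coe_image hPc)
        (fun l₁ l₂ => ?_) l
      obtain ⟨y, hy⟩ := exists_coe_eq_mul hgen l₂ a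
      refine ⟨_, hbase l₁ y (left_mul_mem_restrictedAlgebra ha l₂ hy), ?_⟩
      change (((ηL l₁).fst y : C) : 𝓜(ℂ, C)) = _
      rw [← mul_coe, hy, map_mul ηL, mul_assoc]
    · intro x l a ha h
      let _ := CStarAlgebra.spectralOrder L
      have := CStarAlgebra.spectralOrderedRing L
      have hu := CStarAlgebra.increasingApproximateUnit L
      exact hPc.mem_of_tendsto (tendsto_of_mem_hereditary hu.toIsApproximateUnit
        hu.eventually_norm (mul_mem_hereditary hgen ha l h))
        (Filter.Eventually.of_forall fun u =>
          hbase u x (right_mul_mem_restrictedAlgebra ha l h))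
  intro d
  obtain ⟨d', hd', h⟩ := hall d d.2
  exact Subtype.ext (a1 := d') (a2 := d) h ▸ hd'

/-- `C_L^∨` is generated by products with `L` on the left, whereas (CP4) has `L` on the right; the
involution exchanges the two families. -/
theorem restricted_isGenerating (hgen : IsGenerating ηA ηL) :
    IsGenerating (restrictedA hgen) (restrictedL hgen) where
  mul_mem a l := by
    obtain ⟨c, hc⟩ := hgen.mul_mem (a : A) l
    refine ⟨⟨c, right_mul_mem_restrictedAlgebra a.2 l hc⟩, multiplier_ext fun d => ?_⟩
    ext
    have := congrArg (fun m : 𝓜(ℂ, C) => m.fst d) hc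
    simpa using this
  generates := by
    rw [eq_top_iff]
    rintro ⟨d, hd⟩ -
    set E := (NonUnitalStarAlgebra.adjoin ℂ {c : restrictedAlgebra ηA ηL | ∃ a l,
      (c : 𝓜(ℂ, restrictedAlgebra ηA ηL)) =
        restrictedA hgen a * restrictedL hgen l}).topologicalClosure
    let P := E.map (NonUnitalStarSubalgebraClass.subtype (restrictedAlgebra ηA ηL))
    have hD := isClosed_restrictedAlgebra (ηA := ηA) (ηL := ηL)
    have hPc : IsClosed (P : Set C) :=
      hD.isClosedEmbedding_subtypeVal.isClosedMap _
        (NonUnitalStarSubalgebra.isClosed_topologicalClosure _)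
    have hr : ∀ (x : C) (l : L), ∀ a ∈ carrierAlgebra ηA ηL,
        (x : 𝓜(ℂ, C)) = ηA a * ηL l → x ∈ P := by
      intro x l a ha h
      refine ⟨⟨x, right_mul_mem_restrictedAlgebra ha l h⟩,
        NonUnitalStarSubalgebra.le_topologicalClosure _
          (NonUnitalStarAlgebra.subset_adjoin ℂ _ ⟨⟨a, ha⟩, l, multiplier_ext fun d => ?_⟩), rfl⟩
      ext
      have := congrArg (fun m : 𝓜(ℂ, C) => m.fst d) h
      simpa using this
    have hle : restrictedAlgebra ηA ηL ≤ P := by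
      refine NonUnitalStarSubalgebra.topologicalClosure_minimal _
        (NonUnitalStarAlgebra.adjoin_le ?_) hPc
      rintro x ⟨l, a, ha, h⟩
      have := hr (star x) (star l) (star a) (star_mem ha) (by
        rw [← star_coe, h, star_mul, ← map_star ηL, ← map_star ηA])
      simpa using star_mem this
    obtain ⟨d', hd', h⟩ := hle hd
    exact Subtype.ext (a1 := d') (a2 := ⟨d, hd⟩) h ▸ hd'

end Restricted

/-! ### Consequences of covariance in a faithful representation -/

section Covariance

variable {G : Type*} [Group G] {A L C : Type*} [NonUnitalCStarAlgebra A]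
  [NonUnitalCStarAlgebra L] [NonUnitalCStarAlgebra C]
  {ηA : A →⋆ₙₐ[ℂ] 𝓜(ℂ, C)} {ηL : L →⋆ₙₐ[ℂ] 𝓜(ℂ, C)}
  {H : Type*} [NormedAddCommGroup H] [InnerProductSpace ℂ H] [CompleteSpace H]

theorem pullRep_mul {B : Type*} [NonUnitalCStarAlgebra B] (φ : B →⋆ₙₐ[ℂ] 𝓜(ℂ, C))
    {ρ : C →⋆ₙₐ[ℂ] (H →L[ℂ] H)} (hρ : IsNondegenerateRep ρ) (b : B) (c : C) :
    pullRep φ ρ hρ b * ρ c = ρ ((φ b).fst c) :=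
  repExt_apply hρ (φ b) c

/-- `ρ(C_L)` is invariant under the extension of `ρ̃ ∘ η_L` to `M(L)`. -/
theorem exists_mem_hereditary_rep_eq {ρ : C →⋆ₙₐ[ℂ] (H →L[ℂ] H)} (hρ : IsLRep ηL ρ)
    (hinj : Function.Injective ρ) (m : 𝓜(ℂ, L)) {x : C} (hx : x ∈ hereditary ηL) :
    ∃ y ∈ hereditary ηL,
      ρ y = repExt (pullRep ηL ρ hρ.nondegenerate) hρ.pull_nondegenerate m * ρ x := by
  set U := repExt (pullRep ηL ρ hρ.nondegenerate) hρ.pull_nondegenerate m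
  let Q : Submodule ℂ (H →L[ℂ] H) := (hereditary ηL).map (ρ : C →ₗ[ℂ] (H →L[ℂ] H))
  -- An injective representation is isometric, so `ρ(C_L)` is closed and the claim reduces to the
  -- products spanning `C_L`.
  have hQ : IsClosed (Q : Set (H →L[ℂ] H)) :=
    (NonUnitalStarAlgHom.isometry ρ hinj).isClosedEmbedding.isClosedMap _ isClosed_hereditary
  let P : Submodule ℂ C := Q.comap
    (LinearMap.mulLeft ℂ U ∘ₗ (ρ : C →ₗ[ℂ] (H →L[ℂ] H)))
  have hP : IsClosed (P : Set C) :=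
    hQ.preimage (continuous_const.mul (continuous_starHom ρ))
  refine hereditary_le hP ?_ hx
  intro x l c l' h
  -- Only the outermost left factor `η_L(l)` has to be pulled through `ρ`; there `U` absorbs into it
  -- as `m l`. The right factor stays hidden under the adjoints.
  have hx' : x = (ηL l).fst (star ((ηL (star l')).fst (star c))) := by
    apply coe_injective
    beta_reduce
    rw [← mul_coe, ← star_coe, ← mul_coe, star_mul, ← map_star ηL, star_star, ← star_coe,
      star_star, h, mul_assoc]
  have hy : (((ηL (m.fst l)).fst (star ((ηL (star l')).fst (star c))) : C) : 𝓜(ℂ, C)) =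
      ηL (m.fst l) * (c : 𝓜(ℂ, C)) * ηL l' := by
    rw [← mul_coe, ← star_coe, ← mul_coe, star_mul, ← map_star ηL, star_star, ← star_coe,
      star_star, mul_assoc]
  refine ⟨_, mem_hereditary _ _ _ hy, ?_⟩
  change ρ _ = U * ρ x
  rw [hx', ← pullRep_mul ηL hρ.nondegenerate, ← pullRep_mul ηL hρ.nondegenerate, ← mul_assoc,
    repExt_apply]

/-- A subalgebra `D` on which `η_L` acts non-degenerately: the representation `ρ` intertwines the
multiplier extension of this action with the extension of `ρ̃ ∘ η_L` to `M(L)`. -/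
theorem rep_homExt {ρ : C →⋆ₙₐ[ℂ] (H →L[ℂ] H)} (hρ : IsLRep ηL ρ)
    {D : NonUnitalStarSubalgebra ℂ C} [IsClosed (D : Set C)] {φ : L →⋆ₙₐ[ℂ] 𝓜(ℂ, D)}
    (hφ : IsNondegenerateHom φ) (h : ∀ l d, ((φ l).fst d : C) = (ηL l).fst d)
    (m : 𝓜(ℂ, L)) (d : D) :
    ρ ((homExt φ hφ m).fst d) =
      repExt (pullRep ηL ρ hρ.nondegenerate) hρ.pull_nondegenerate m * ρ d := by
  set U := repExt (pullRep ηL ρ hρ.nondegenerate) hρ.pull_nondegenerate m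
  -- On vectors `φ(l) d`, which span a dense subspace, both sides equal `ρ(η_L(m l) d)`.
  refine hφ.induction (P := fun d => ρ ((homExt φ hφ m).fst d) = U * ρ d) ?_ ?_ d
  · intro x hx
    induction hx using Submodule.span_induction with
    | mem x hx =>
      obtain ⟨l, d, rfl⟩ := hx
      have key := congrArg (fun n : 𝓜(ℂ, D) => n.fst d) (homExt_apply hφ m l)
      change (homExt φ hφ m).fst ((φ l).fst d) = _ at key
      rw [key, h, h, ← pullRep_mul ηL hρ.nondegenerate, ← pullRep_mul ηL hρ.nondegenerate,
        ← mul_assoc, repExt_apply]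
    | zero => simp
    | add x y _ _ hx hy => simp [hx, hy, mul_add]
    | smul z x _ hx => simp [hx]
  · have hc := continuous_starHom ρ
    exact isClosed_eq
      (hc.comp (continuous_subtype_val.comp (homExt φ hφ m).fst.continuous))
      (continuous_const.mul (hc.comp continuous_subtype_val))

/-- Covariance of `ρ` for the unitary representation of `G` given by `ρ̃ ∘ η_L`. -/
def IsCovariantRep (α : G →* (A ≃⋆ₐ[ℂ] A)) (η : G →* unitary 𝓜(ℂ, L)) (ηA : A →⋆ₙₐ[ℂ] 𝓜(ℂ, C))
    {ρ : C →⋆ₙₐ[ℂ] (H →L[ℂ] H)} (hρ : IsLRep ηL ρ) : Prop :=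
  ∀ (g : G) (a : A),
    (groupRep η (pullRep ηL ρ hρ.nondegenerate) hρ.pull_nondegenerate g : H →L[ℂ] H) *
      pullRep ηA ρ hρ.nondegenerate a *
      star (groupRep η (pullRep ηL ρ hρ.nondegenerate) hρ.pull_nondegenerate g : H →L[ℂ] H) =
    pullRep ηA ρ hρ.nondegenerate (α g a)

variable {α : G →* (A ≃⋆ₐ[ℂ] A)} {η : G →* unitary 𝓜(ℂ, L)} {ρ : C →⋆ₙₐ[ℂ] (H →L[ℂ] H)}
  {hρ : IsLRep ηL ρ}

/-- The right-nested form lets the three operators be absorbed into `ρ` one at a time, starting from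
`ρ c`. -/
theorem IsCovariantRep.rep_fst (hc : IsCovariantRep α η ηA hρ) (g : G) (a : A) (c : C) :
    ρ ((ηA (α g a)).fst c) =
      repExt (pullRep ηL ρ hρ.nondegenerate) hρ.pull_nondegenerate (η g) *
        (pullRep ηA ρ hρ.nondegenerate a *
          (repExt (pullRep ηL ρ hρ.nondegenerate) hρ.pull_nondegenerate
            (star (η g : 𝓜(ℂ, L))) * ρ c)) := by
  rw [← pullRep_mul ηA hρ.nondegenerate, ← hc g a, map_star]
  simp only [mul_assoc]
  rfl

/-- Applying `(U g)*`, then `a`, then `U g` to `ρ c` stays inside `ρ(C_L)` at each stage;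
injectivity of `ρ` carries the result back to `C`. -/
theorem IsCovariantRep.fst_mem_hereditary (hc : IsCovariantRep α η ηA hρ)
    (hinj : Function.Injective ρ) (g : G) {a : A}
    (ha : ∀ c ∈ hereditary ηL, (ηA a).fst c ∈ hereditary ηL) {c : C} (hcm : c ∈ hereditary ηL) :
    (ηA (α g a)).fst c ∈ hereditary ηL := by
  obtain ⟨x, hx, h1⟩ := exists_mem_hereditary_rep_eq hρ hinj (star (η g : 𝓜(ℂ, L))) hcm
  obtain ⟨y, hy, h2⟩ := exists_mem_hereditary_rep_eq hρ hinj (η g : 𝓜(ℂ, L)) (ha x hx)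
  have : (ηA (α g a)).fst c = y := hinj (by
    rw [hc.rep_fst, ← h1, pullRep_mul, h2])
  exact this ▸ hy

theorem IsCovariantRep.mem_carrierAlgebra (hc : IsCovariantRep α η ηA hρ)
    (hinj : Function.Injective ρ) (g : G) {a : A} (ha : a ∈ carrierAlgebra ηA ηL) :
    α g a ∈ carrierAlgebra ηA ηL :=
  ⟨fun _ h => hc.fst_mem_hereditary hinj g ha.1 h, fun _ h => by
    rw [← map_star (α g)]; exact hc.fst_mem_hereditary hinj g ha.2 h⟩

/-- The action of `G` on `A_L` obtained by restriction of an action on `A` leaving it invariant. -/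
def restrictAction (α : G →* (A ≃⋆ₐ[ℂ] A)) {B : NonUnitalStarSubalgebra ℂ A}
    (h : ∀ g, ∀ a ∈ B, α g a ∈ B) : G →* (B ≃⋆ₐ[ℂ] B) where
  toFun g :=
    { toFun := fun a => ⟨α g a, h g a a.2⟩
      invFun := fun a => ⟨α g⁻¹ a, h g⁻¹ a a.2⟩
      left_inv := fun a => Subtype.ext (by
        change (α g⁻¹ * α g) (a : A) = a
        rw [← map_mul, inv_mul_cancel, map_one]; rfl)
      right_inv := fun a => Subtype.ext (by
        change (α g * α g⁻¹) (a : A) = a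
        rw [← map_mul, mul_inv_cancel, map_one]; rfl)
      map_mul' := fun a b => Subtype.ext (map_mul (α g) (a : A) b)
      map_add' := fun a b => Subtype.ext (map_add (α g) (a : A) b)
      map_star' := fun a => Subtype.ext (map_star (α g) (a : A))
      map_smul' := fun z a => Subtype.ext (map_smul (α g) z (a : A)) }
  map_one' := by ext a; change (α 1) (a : A) = a; rw [map_one]; rfl
  map_mul' g k := by
    ext a; change (α (g * k)) (a : A) = α g (α k a); rw [map_mul]; rfl

/-- Covariance is tested on elements `d` of `C_L^∨` after applying the injective `ρ`. There the
multiplier extension of the restricted `η_L` becomes multiplication by `U`, and both sides become `U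
g · a · (U g)* · ρ d`. -/
theorem IsCovariantRep.restricted_isCrossedProductHost (hc : IsCovariantRep α η ηA hρ)
    (hinj : Function.Injective ρ) (hgen : IsGenerating ηA ηL) :
    IsCrossedProductHost (restrictAction α fun g _ ha => hc.mem_carrierAlgebra hinj g ha) η
      (restrictedA hgen) (restrictedL hgen) where
  nondegenerate := restrictedL_nondegenerate hgen
  generating := restricted_isGenerating hgen
  covariant g a := by
    refine multiplier_ext fun d => Subtype.ext (hinj ?_)
    have hext := rep_homExt hρ (restrictedL_nondegenerate hgen) (restrictedL_fst hgen)
    rw [restrictedA_fst]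
    refine Eq.trans ?_ (hc.rep_fst g a d).symm
    rw [← map_star, DoubleCentralizer.mul_fst, DoubleCentralizer.mul_fst]
    rw [mul_apply_eq_comp, mul_apply_eq_comp, hext, restrictedA_fst,
      ← pullRep_mul ηA hρ.nondegenerate, hext]

end Covariance

end CrossedProductHost

end

/-! ### The proposition, from the universal `L`-representation -/

open CrossedProductHost in
theorem mainTheorem5 {G : Type*} [Group G] [TopologicalSpace G] [IsTopologicalGroup G]
    {A L C : Type*} [NonUnitalCStarAlgebra A] [NonUnitalCStarAlgebra L] [NonUnitalCStarAlgebra C]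
    [PartialOrder C] [StarOrderedRing C]
    (α : G →* (A ≃⋆ₐ[ℂ] A)) (η : G →* unitary 𝓜(ℂ, L)) (hη : IsHostAlgebra η)
    (ηA : A →⋆ₙₐ[ℂ] 𝓜(ℂ, C)) (ηL : L →⋆ₙₐ[ℂ] 𝓜(ℂ, C))
    (hcov : IsUniversallyCovariant α η ηA ηL) (hgen : IsGenerating ηA ηL) :
    ∃ (αL : G →* (carrierAlgebra ηA ηL ≃⋆ₐ[ℂ] carrierAlgebra ηA ηL))
      (ηA' : carrierAlgebra ηA ηL →⋆ₙₐ[ℂ] 𝓜(ℂ, restrictedAlgebra ηA ηL))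
      (ηL' : L →⋆ₙₐ[ℂ] 𝓜(ℂ, restrictedAlgebra ηA ηL)),
      (∀ g a, (αL g a : A) = α g a) ∧
      (∀ a c, ((ηA' a).fst c : C) = (ηA a).fst c) ∧
      (∀ l c, ((ηL' l).fst c : C) = (ηL l).fst c) ∧
      IsCrossedProductHost αL η ηA' ηL' := by
  have hc : IsCovariantRep α η ηA (universalRep_isLRep ηL) := hcov.covariant
  exact ⟨restrictAction α fun g _ ha => hc.mem_carrierAlgebra hcov.faithful g ha,
    restrictedA hgen, restrictedL hgen, fun _ _ => rfl, fun _ _ => rfl, fun _ _ => rfl,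
    hc.restricted_isCrossedProductHost hcov.faithful hgen⟩
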